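/- For $n\in\mathbb N$ and $p\in[0,1]$ let $G_{n,p}$ be the binomial random graph on the vertex set $\{1,\dots,n\}$, in which each of the $\binom n2$ possible edges is present independently with probability $p$. **Theorem.** For every $\eta>0$ there are $\varepsilon>0$ and $C$ (depending only on $\eta$) such that the following holds. Let $p=p(n)\in[0,1]$ satisfy $p(n)>Cn^{-1/2}$ for all sufficiently large $n$. Then with probability tending to $1$ as $n\to\infty$, every triangle-free subgraph $F$ of $G=G_{n,p}$ having at least $(1-\varepsilon)n^2p/4$ edges can be made bipartite by deleting at most $\eta n^2p$ of its edges. -/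

import Mathlib

open Filter Topology

/-! ### Certificates and the shrinking step for a bounded-degree graph. -/

section Containers

open Finset
open scoped Classical

variable {V : Type*}

/-! The proof uses hypergraph containers. Triangles form a linear 3-uniform hypergraph on the set of
pairs: two edges determine the third. For such systems `certified_container` gives every triple-free
set `I` a container with few triples, determined by a small subset `S` of `I`, the fingerprint. For
triangles in `Fin n` fingerprints have `O(n^{3/2})` elements (`certified_graph_container`).

A container with few triangles is sparse or close to bipartite, by triangle removal and Füredi's
stability argument. So a dense triangle-free `F` far from bipartite, inside such a container, has
more edges in some set `B` fixed by the container than `G_{n,p}` should have there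
(`exists_overfull_set`). For each fingerprint this event, intersected with `S ⊆ G`, has probability
at most `(zp)^|S| exp(-bn²p)`, where `z = 1 + η/2` and `b > 0` depends on `η` only. The union bound
over fingerprints costs only a small multiple of `n²p` in the exponent, because `n²p ≥ C n^{3/2}`
(`binomialRandom_real_exists_le`). -/

/-- There is a map `h`, assigning to every `I ∈ 𝓘` a set `h I` with `P I (h I)`, whose value at `I`
is determined by some set of at most `s` elements of `I`. -/
def Certified (s : ℕ) (𝓘 : Set (Finset V)) (P : Finset V → Finset V → Prop) : Prop :=
  ∃ h : Finset V → Finset V, ∀ I ∈ 𝓘, P I (h I) ∧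
    ∃ S ⊆ I, #S ≤ s ∧ ∀ T, S ⊆ T → T ⊆ I → h T = h I

lemma Certified.mono {s t : ℕ} {𝓘 𝓙 : Set (Finset V)} {P Q : Finset V → Finset V → Prop}
    (h : Certified s 𝓘 P) (hst : s ≤ t) (hIJ : 𝓙 ⊆ 𝓘) (hPQ : ∀ I ∈ 𝓙, ∀ A, P I A → Q I A) :
    Certified t 𝓙 Q := by
  obtain ⟨f, hf⟩ := h
  refine ⟨f, fun I hI => ?_⟩
  obtain ⟨h1, S, hS, hc, h2⟩ := hf I (hIJ hI)
  exact ⟨hPQ I hI _ h1, S, hS, hc.trans hst, h2⟩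

lemma certified_const {s : ℕ} {𝓘 : Set (Finset V)} {P : Finset V → Finset V → Prop}
    (A : Finset V) (h : ∀ I ∈ 𝓘, P I A) : Certified s 𝓘 P :=
  ⟨fun _ => A, fun I hI => ⟨h I hI, ∅, empty_subset _, by simp, fun _ _ _ => rfl⟩⟩

lemma Certified.bind {s t : ℕ} {𝓘 : Set (Finset V)} {P Q : Finset V → Finset V → Prop}
    (h : Certified s 𝓘 P) (h' : ∀ A, Certified t {I | I ∈ 𝓘 ∧ P I A} Q) :
    Certified (s + t) 𝓘 Q := by
  obtain ⟨f, hf⟩ := h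
  choose g hg using h'
  refine ⟨fun I => g (f I) I, fun I hI => ?_⟩
  obtain ⟨h1, S, hS, hc, h2⟩ := hf I hI
  obtain ⟨h1', S', hS', hc', h2'⟩ := hg (f I) I ⟨hI, h1⟩
  refine ⟨h1', S ∪ S', union_subset hS hS', (card_union_le _ _).trans (by omega), ?_⟩
  intro T hT hTI
  simp only
  rw [h2 T (subset_union_left.trans hT) hTI]
  exact h2' T (subset_union_right.trans hT) hTI

/-- One greedy choice costs one fingerprint element: the least `v ∈ I` with `q v` in a fixed order.
If `v ∈ T ⊆ I`, then `v` is also least in `T`, so `T` makes the same choice; if `I` has no such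
element, neither has `T`. -/
lemma certified_pick [Fintype V] {s : ℕ} {𝓘 : Set (Finset V)} {P : Finset V → Finset V → Prop}
    (q : V → Prop) (h : ∀ v, q v → Certified s {I | I ∈ 𝓘 ∧ v ∈ I} P)
    (h' : Certified s {I | I ∈ 𝓘 ∧ ∀ v ∈ I, ¬ q v} P) : Certified (s + 1) 𝓘 P := by
  obtain ⟨f₀, hf₀⟩ := h'
  have h2 : ∀ v, ∃ f : Finset V → Finset V, q v → ∀ I ∈ {I | I ∈ 𝓘 ∧ v ∈ I}, P I (f I) ∧
    ∃ S ⊆ I, #S ≤ s ∧ ∀ T, S ⊆ T → T ⊆ I → f T = f I := by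
    intro v
    by_cases hv : q v
    · obtain ⟨f, hf⟩ := h v hv
      exact ⟨f, fun _ => hf⟩
    · exact ⟨fun _ => ∅, fun hq => absurd hq hv⟩
  choose f hf using h2
  let r := Fintype.equivFin V
  have hmin : ∀ I : Finset V, (∃ v ∈ I, q v) → ∃ v, (v ∈ I ∧ q v) ∧ ∀ w ∈ I, q w → r v ≤ r w := by
    rintro I ⟨v, hv, hqv⟩
    obtain ⟨a, ha, hmin⟩ := exists_min_image {w ∈ I | q w} r ⟨v, by simp [hv, hqv]⟩
    simp only [mem_filter] at ha hmin
    exact ⟨a, ha, fun w hw hqw => hmin w ⟨hw, hqw⟩⟩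
  let F : Finset V → Finset V := fun I =>
    if hI : ∃ v ∈ I, q v then f (hmin I hI).choose I else f₀ I
  refine ⟨F, fun I hI => ?_⟩
  by_cases hq : ∃ v ∈ I, q v
  · have hF : F I = f (hmin I hq).choose I := dif_pos hq
    obtain ⟨⟨hvI, hqv⟩, hvmin⟩ := (hmin I hq).choose_spec
    rw [hF]
    set v := (hmin I hq).choose
    obtain ⟨h1, S, hS, hc, h2⟩ := hf v hqv I ⟨hI, hvI⟩
    refine ⟨h1, insert v S, insert_subset hvI hS, (card_insert_le _ _).trans (by omega), ?_⟩
    intro T hT hTI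
    have hvT : v ∈ T := hT (mem_insert_self _ _)
    have hqT : ∃ v ∈ T, q v := ⟨v, hvT, hqv⟩
    have hFT : F T = f (hmin T hqT).choose T := dif_pos hqT
    obtain ⟨⟨hwT, hqw⟩, hwmin⟩ := (hmin T hqT).choose_spec
    have : (hmin T hqT).choose = v :=
      r.injective (le_antisymm (hwmin v hvT hqv) (hvmin _ (hTI hwT) hqw))
    rw [hFT, this]
    exact h2 T ((subset_insert _ _).trans hT) hTI
  · have hF : F I = f₀ I := dif_neg hq
    rw [hF]
    obtain ⟨h1, S, hS, hc, h2⟩ := hf₀ I ⟨hI, fun v hv hqv => hq ⟨v, hv, hqv⟩⟩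
    refine ⟨h1, S, hS, hc.trans (Nat.le_succ _), fun T hT hTI => ?_⟩
    have hFT : F T = f₀ T := dif_neg fun ⟨v, hv, hqv⟩ => hq ⟨v, hTI hv, hqv⟩
    rw [hFT]
    exact h2 T hT hTI

/-- A symmetric ternary relation in which two entries determine the third and every element lies
in at most `d` ordered triples as first entry. -/
structure IsLinearTriples (T : V → V → V → Prop) (d : ℕ) [Fintype V] : Prop where
  swap_left : ∀ u v w, T u v w → T v u w
  swap_right : ∀ u v w, T u v w → T u w v
  unique : ∀ u v w w', T u v w → T u v w' → w = w'
  degree_le : ∀ v, #{y : V × V | T v y.1 y.2} ≤ d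

/-- The number of ordered triples inside `A`. -/
noncomputable def tripleCount (T : V → V → V → Prop) (A : Finset V) : ℕ :=
  ∑ v ∈ A, #{y ∈ A ×ˢ A | T v y.1 y.2}

/-- `A'` is a subset of `A` containing `I` and having at least `δ` fewer elements than `A`. -/
def Shrinks (A : Finset V) (δ : ℝ) (I A' : Finset V) : Prop :=
  I ⊆ A' ∧ A' ⊆ A ∧ (#A' : ℝ) + δ ≤ #A

/-- Used backwards: a large sum forces many elements of value at least `θ`, so the set of light
elements is much smaller than `A`. -/
lemma sum_le_of_le_of_lt (A : Finset V) (f : V → ℕ) (D : ℕ) (θ : ℝ) (hθ : 0 ≤ θ)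
    (hf : ∀ v ∈ A, f v ≤ D) :
    ((∑ v ∈ A, f v : ℕ) : ℝ) ≤ D * (#A - #{v ∈ A | (f v : ℝ) < θ}) + θ * #A := by
  have h1 : (#A : ℝ) - #{v ∈ A | (f v : ℝ) < θ} = #{v ∈ A | ¬ (f v : ℝ) < θ} := by
    have := card_filter_add_card_filter_not (s := A) (fun v => (f v : ℝ) < θ)
    rw [← this]; push_cast; ring
  rw [h1]
  push_cast
  rw [← sum_filter_add_sum_filter_not A (fun v => (f v : ℝ) < θ)]
  have h2 : ∑ v ∈ A with (f v : ℝ) < θ, (f v : ℝ) ≤ θ * #A := by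
    calc ∑ v ∈ A with (f v : ℝ) < θ, (f v : ℝ) ≤ ∑ v ∈ A with (f v : ℝ) < θ, θ :=
          sum_le_sum fun v hv => (mem_filter.1 hv).2.le
      _ = #{v ∈ A | (f v : ℝ) < θ} * θ := by simp
      _ ≤ #A * θ := by gcongr; exact filter_subset _ _
      _ = θ * #A := mul_comm _ _
  have h3 : ∑ v ∈ A with ¬ (f v : ℝ) < θ, (f v : ℝ) ≤ D * #{v ∈ A | ¬ (f v : ℝ) < θ} := by
    calc ∑ v ∈ A with ¬ (f v : ℝ) < θ, (f v : ℝ) ≤ ∑ v ∈ A with ¬ (f v : ℝ) < θ, (D : ℝ) :=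
          sum_le_sum fun v hv => by exact_mod_cast hf v (mem_filter.1 hv).1
      _ = D * #{v ∈ A | ¬ (f v : ℝ) < θ} := by simp [mul_comm]
  linarith

/-- Every edge lost in passing to `A'` has an end in `A \ A'`; the factor 2 is there because edges
are counted as ordered pairs. -/
lemma sum_card_le_sum_card_inter (G : V → Finset V) (A A' : Finset V) (K : ℕ)
    (hsymm : ∀ u w, w ∈ G u → u ∈ G w) (hdeg : ∀ u, #(G u) ≤ K) (hA' : A' ⊆ A)
    (hsub : ∀ u, G u ⊆ A) :
    ∑ v ∈ A, #(G v) ≤ ∑ v ∈ A', #(G v ∩ A') + 2 * (K * #(A \ A')) := by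
  have h1 : ∑ v ∈ A', #(G v \ A') ≤ ∑ w ∈ A \ A', #(G w) := by
    calc ∑ v ∈ A', #(G v \ A') = ∑ v ∈ A', #(bipartiteAbove (fun v w => w ∈ G v) (A \ A') v) := by
          refine sum_congr rfl fun v _ => congrArg card ?_
          ext w
          have := @hsub v w
          simp only [Finset.mem_sdiff, mem_bipartiteAbove]
          tauto
      _ = ∑ w ∈ A \ A', #(bipartiteBelow (fun v w => w ∈ G v) A' w) :=
          sum_card_bipartiteAbove_eq_sum_card_bipartiteBelow _
      _ ≤ ∑ w ∈ A \ A', #(G w) := by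
          refine sum_le_sum fun w _ => card_le_card fun v hv => ?_
          exact hsymm _ _ (mem_bipartiteBelow _ |>.1 hv).2
  have h2 : ∑ w ∈ A \ A', #(G w) ≤ K * #(A \ A') := by
    calc ∑ w ∈ A \ A', #(G w) ≤ ∑ w ∈ A \ A', K := sum_le_sum fun w _ => hdeg w
      _ = K * #(A \ A') := by simp [mul_comm]
  have h3 : ∑ v ∈ A', #(G v) = ∑ v ∈ A', #(G v ∩ A') + ∑ v ∈ A', #(G v \ A') := by
    rw [← sum_add_distrib]
    exact sum_congr rfl fun v _ => (card_inter_add_card_sdiff _ _).symm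
  have h4 := sum_sdiff hA' (f := fun v => #(G v))
  omega

/-- Picking `v ∈ I` of degree at least `θ` in `A'` allows its neighbours to be discarded, so the
excess of `A'` over the target size, at most `kθ`, drops by `θ`. If `I` has no such `v`, it lies
among the light vertices. While `A'` misses fewer than `δ` elements of `A`, at most `2Kδ` of the
degree sum is lost, and the third `Kδ` in `hM` makes the light vertices fewer by `δ`. -/
lemma certified_shrinks_of_graph [Fintype V] (G : V → Finset V) (A : Finset V) (K : ℕ)
    (hsymm : ∀ u w, w ∈ G u → u ∈ G w) (hdeg : ∀ u, #(G u) ≤ K) (hK : 0 < K)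
    (hsub : ∀ u, G u ⊆ A) {δ θ M : ℝ} (hθ : 0 < θ) (hM : 3 * K * δ + θ * #A ≤ M)
    (hG : M ≤ (∑ v ∈ A, #(G v) : ℕ)) (k : ℕ) :
    ∀ A' ⊆ A, (#A' : ℝ) + δ ≤ #A + k * θ →
      Certified k {I | I ⊆ A' ∧ ∀ v ∈ I, Disjoint I (G v)} (Shrinks A δ) := by
  induction k with
  | zero =>
    intro A' hA' hk
    exact certified_const A' fun I hI => ⟨hI.1, hA', by simpa using hk⟩
  | succ k ih =>
    intro A' hA' hk
    by_cases hlt : (#A' : ℝ) + δ ≤ #A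
    · exact certified_const A' fun I hI => ⟨hI.1, hA', hlt⟩
    refine certified_pick (fun v => θ ≤ #(G v ∩ A')) (fun v hv => ?_) ?_
    · refine (ih (A' \ G v) (sdiff_subset.trans hA') ?_).mono le_rfl ?_ fun _ _ _ h => h
      · have h1 : (#(A' ∩ G v) : ℝ) + #(A' \ G v) = #A' := by
          exact_mod_cast card_inter_add_card_sdiff A' (G v)
        rw [inter_comm] at h1
        push_cast at hk
        linarith
      · rintro I ⟨⟨hIA, hI⟩, hvI⟩
        exact ⟨fun w hw => Finset.mem_sdiff.2 ⟨hIA hw, disjoint_left.1 (hI v hvI) hw⟩, hI⟩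
    · refine certified_const {v ∈ A' | (#(G v ∩ A') : ℝ) < θ} ?_
      rintro I ⟨⟨hIA, hI⟩, hq⟩
      refine ⟨fun v hv => mem_filter.2 ⟨hIA hv, not_le.1 (hq v hv)⟩,
        (filter_subset _ _).trans hA', ?_⟩
      have h1 : ((∑ v ∈ A, #(G v) : ℕ) : ℝ) ≤ (∑ v ∈ A', #(G v ∩ A') : ℕ) +
          2 * (K * (#A - #A')) := by
        have := sum_card_le_sum_card_inter G A A' K hsymm hdeg hA' hsub
        have h3 : (#(A \ A') : ℝ) = #A - #A' := by
          rw [card_sdiff_of_subset hA', Nat.cast_sub (card_le_card hA')]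
        rw [← h3]
        exact_mod_cast this
      have h2 := sum_le_of_le_of_lt A' (fun v => #(G v ∩ A')) K θ hθ.le
        fun v _ => (card_le_card inter_subset_left).trans (hdeg v)
      have h4 : (#A' : ℝ) ≤ #A := by exact_mod_cast card_le_card hA'
      have hK' : (0 : ℝ) < K := by exact_mod_cast hK
      have h5 : (K : ℝ) * (#A - #A') ≤ K * δ := by gcongr; linarith
      have h6 : θ * #A' ≤ θ * #A := by gcongr
      have h7 : (K : ℝ) * δ ≤ K * (#A' - #{v ∈ A' | (#(G v ∩ A') : ℝ) < θ}) := by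
        linarith
      have := le_of_mul_le_mul_left h7 hK'
      linarith

end Containers

/-! ### Building the bounded-degree graph from links, and the container lemma. -/

section LinkGraph

open Finset
open scoped Classical

variable {V : Type*}

/-- The pairs in `A` completing `v` to a triple of `T` that are not yet adjacent in `G` and whose
elements both have degree less than `K` in `G`. -/
noncomputable def newPairs (T : V → V → V → Prop) (A : Finset V) (K : ℕ) (G : V → Finset V)
    (v : V) : Finset (V × V) :=
  {y ∈ A ×ˢ A | T v y.1 y.2 ∧ y.2 ∉ G y.1 ∧ #(G y.1) < K ∧ #(G y.2) < K}

/-- The graph obtained from `G` by adding the pairs in `newPairs T A K G v`. -/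
noncomputable def addLink (T : V → V → V → Prop) (A : Finset V) (K : ℕ) (G : V → Finset V)
    (v u : V) : Finset V :=
  G u ∪ {w ∈ A | u ∈ A ∧ T v u w ∧ #(G u) < K ∧ #(G w) < K}

/-- `G` is the neighbourhood function of a graph on `A` with maximum degree at most `K`. -/
structure IsBoundedGraph (A : Finset V) (K : ℕ) (G : V → Finset V) : Prop where
  symm : ∀ u w, w ∈ G u → u ∈ G w
  card_le : ∀ u, #(G u) ≤ K
  subset : ∀ u, G u ⊆ A

variable {T : V → V → V → Prop} {d : ℕ} {A : Finset V} {K : ℕ} {G : V → Finset V}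

lemma sum_card_addLink (T : V → V → V → Prop) (A : Finset V) (K : ℕ) (G : V → Finset V) (v : V) :
    ∑ u ∈ A, #(addLink T A K G v u) = ∑ u ∈ A, #(G u) + #(newPairs T A K G v) := by
  have h1 : #(newPairs T A K G v) =
      ∑ u ∈ A, #({w ∈ A | u ∈ A ∧ T v u w ∧ #(G u) < K ∧ #(G w) < K} \ G u) := by
    rw [← card_sigma, newPairs]
    refine card_bij' (fun y _ => ⟨y.1, y.2⟩) (fun y _ => (y.1, y.2)) ?_ ?_ ?_ ?_
    · rintro ⟨a, b⟩ h
      simp only [mem_filter, mem_product, mem_sigma, Finset.mem_sdiff] at h ⊢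
      tauto
    · rintro ⟨a, b⟩ h
      simp only [mem_filter, mem_product, mem_sigma, Finset.mem_sdiff] at h ⊢
      tauto
    · intros; rfl
    · intros; rfl
  rw [h1, ← sum_add_distrib]
  refine sum_congr rfl fun u _ => ?_
  rw [addLink, ← union_sdiff_self_eq_union, card_union_of_disjoint disjoint_sdiff]

lemma card_saturated_mul_le (A : Finset V) (K : ℕ) (G : V → Finset V) :
    K * #{u ∈ A | K ≤ #(G u)} ≤ ∑ u ∈ A, #(G u) := by
  calc K * #{u ∈ A | K ≤ #(G u)} = ∑ u ∈ A with K ≤ #(G u), K := by simp [mul_comm]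
    _ ≤ ∑ u ∈ A with K ≤ #(G u), #(G u) := sum_le_sum fun u hu => (mem_filter.1 hu).2
    _ ≤ ∑ u ∈ A, #(G u) := sum_le_sum_of_subset (filter_subset _ _)

/-- `I` contains no triple of `T`. -/
def TripleFree (T : V → V → V → Prop) (I : Finset V) : Prop :=
  ∀ u ∈ I, ∀ v ∈ I, ∀ w ∈ I, ¬ T u v w

variable [Fintype V]

/-- By linearity the link of `v` is a matching, so degrees rise by at most one, and only at vertices
of degree below `K`. -/
lemma IsBoundedGraph.addLink (hG : IsBoundedGraph A K G) (hT : IsLinearTriples T d) (v : V) :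
    IsBoundedGraph A K (addLink T A K G v) where
  symm u w h := by
    simp only [_root_.addLink, mem_union, mem_filter] at h ⊢
    rcases h with h | ⟨h1, h2, h3, h4, h5⟩
    · exact Or.inl (hG.symm _ _ h)
    · exact Or.inr ⟨h2, h1, hT.swap_right _ _ _ h3, h5, h4⟩
  card_le u := by
    by_cases hu : #(G u) < K
    · refine (card_union_le _ _).trans ?_
      have : #{w ∈ A | u ∈ A ∧ T v u w ∧ #(G u) < K ∧ #(G w) < K} ≤ 1 := by
        refine card_le_one.2 fun a ha b hb => ?_
        simp only [mem_filter] at ha hb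
        exact hT.unique _ _ _ _ ha.2.2.1 hb.2.2.1
      omega
    · have : _root_.addLink T A K G v u = G u := by
        simp [_root_.addLink, hu]
      rw [this]
      exact hG.card_le u
  subset u := union_subset (hG.subset u) (filter_subset _ _)

lemma sum_card_triples_mem_le (hT : IsLinearTriples T d) (hsub : ∀ u, G u ⊆ A) :
    ∑ v ∈ A, #{y ∈ A ×ˢ A | T v y.1 y.2 ∧ y.2 ∈ G y.1} ≤ ∑ u ∈ A, #(G u) := by
  calc ∑ v ∈ A, #{y ∈ A ×ˢ A | T v y.1 y.2 ∧ y.2 ∈ G y.1}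
      = ∑ v ∈ A, #(bipartiteAbove (fun v (y : V × V) => T v y.1 y.2)
          {y ∈ A ×ˢ A | y.2 ∈ G y.1} v) := by
        refine sum_congr rfl fun v _ => congrArg card ?_
        ext y
        simp only [mem_filter, mem_bipartiteAbove]
        tauto
    _ = ∑ y ∈ A ×ˢ A with y.2 ∈ G y.1, #(bipartiteBelow (fun v (y : V × V) => T v y.1 y.2) A y) :=
        sum_card_bipartiteAbove_eq_sum_card_bipartiteBelow _
    _ ≤ ∑ y ∈ A ×ˢ A with y.2 ∈ G y.1, 1 := by
        refine sum_le_sum fun y _ => card_le_one.2 fun a ha b hb => ?_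
        rw [mem_bipartiteBelow] at ha hb
        exact hT.unique y.1 y.2 _ _ (hT.swap_right _ _ _ (hT.swap_left _ _ _ ha.2))
          (hT.swap_right _ _ _ (hT.swap_left _ _ _ hb.2))
    _ = ∑ u ∈ A, #(G u) := by
        rw [sum_const, smul_eq_mul, mul_one, ← card_sigma]
        refine card_bij' (fun y _ => ⟨y.1, y.2⟩) (fun y _ => (y.1, y.2)) ?_ ?_ ?_ ?_
        · rintro ⟨a, b⟩ h
          simp only [mem_filter, mem_product, mem_sigma] at h ⊢
          tauto
        · rintro ⟨a, b⟩ h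
          have := @hsub a b
          simp only [mem_filter, mem_product, mem_sigma] at h ⊢
          tauto
        · intros; rfl
        · intros; rfl

lemma sum_card_triples_fst_le (hT : IsLinearTriples T d) (A : Finset V) (p : V → Prop)
    [DecidablePred p] :
    ∑ v ∈ A, #{y ∈ A ×ˢ A | T v y.1 y.2 ∧ p y.1} ≤ d * #{u ∈ A | p u} := by
  calc ∑ v ∈ A, #{y ∈ A ×ˢ A | T v y.1 y.2 ∧ p y.1}
      ≤ ∑ u ∈ A with p u, #{y : V × V | T u y.1 y.2} := by
        rw [← card_sigma, ← card_sigma]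
        refine card_le_card_of_injOn (fun x => ⟨x.2.1, (x.1, x.2.2)⟩) ?_ ?_
        · rintro ⟨v, a, b⟩ h
          simp only [coe_sigma, Set.mem_sigma_iff, mem_coe, mem_filter, mem_product, mem_univ,
            true_and] at h ⊢
          exact ⟨⟨h.2.1.1, h.2.2.2⟩, hT.swap_left _ _ _ h.2.2.1⟩
        · rintro ⟨v, a, b⟩ - ⟨v', a', b'⟩ - h
          simp only [Sigma.mk.injEq, heq_eq_eq, Prod.mk.injEq] at h ⊢
          tauto
    _ ≤ ∑ u ∈ A with p u, d := sum_le_sum fun u _ => hT.degree_le u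
    _ = d * #{u ∈ A | p u} := by simp [mul_comm]

lemma sum_card_triples_snd_le (hT : IsLinearTriples T d) (A : Finset V) (p : V → Prop)
    [DecidablePred p] :
    ∑ v ∈ A, #{y ∈ A ×ˢ A | T v y.1 y.2 ∧ p y.2} ≤ d * #{u ∈ A | p u} := by
  refine le_trans (sum_le_sum fun v _ => ?_) (sum_card_triples_fst_le hT A p)
  refine card_le_card_of_injOn Prod.swap ?_ Prod.swap_injective.injOn
  rintro ⟨a, b⟩ h
  simp only [coe_filter, mem_product, Set.mem_ofPred_eq, Prod.fst_swap, Prod.snd_swap] at h ⊢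
  exact ⟨h.1.symm, hT.swap_right _ _ _ h.2.1, h.2.2⟩

/-- A triple at `v` gives a new pair, a pair already in `G`, or a pair with a saturated end. By
linearity each pair in `G` is counted for at most one `v`; each saturated vertex lies in at most `d`
triples, and the 2 is for the two ends. -/
lemma tripleCount_le (hT : IsLinearTriples T d) (hsub : ∀ u, G u ⊆ A) :
    tripleCount T A ≤ ∑ v ∈ A, #(newPairs T A K G v) + ∑ u ∈ A, #(G u) +
      2 * (d * #{u ∈ A | K ≤ #(G u)}) := by
  have h1 := sum_card_triples_mem_le hT hsub
  have h2 := sum_card_triples_fst_le hT A (fun u => K ≤ #(G u))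
  have h3 := sum_card_triples_snd_le hT A (fun u => K ≤ #(G u))
  have h4 : tripleCount T A ≤ ∑ v ∈ A, (#(newPairs T A K G v) +
      #{y ∈ A ×ˢ A | T v y.1 y.2 ∧ y.2 ∈ G y.1} +
      #{y ∈ A ×ˢ A | T v y.1 y.2 ∧ K ≤ #(G y.1)} +
      #{y ∈ A ×ˢ A | T v y.1 y.2 ∧ K ≤ #(G y.2)}) := by
    refine sum_le_sum fun v _ => ?_
    refine le_trans (card_le_card ?_) ((card_union_le _ _).trans (Nat.add_le_add_right
      ((card_union_le _ _).trans (Nat.add_le_add_right (card_union_le _ _) _)) _))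
    intro y hy
    simp only [newPairs, mem_union, mem_filter] at hy ⊢
    by_cases h5 : y.2 ∈ G y.1
    · tauto
    by_cases h6 : K ≤ #(G y.1)
    · tauto
    by_cases h7 : K ≤ #(G y.2)
    · tauto
    exact Or.inl (Or.inl (Or.inl ⟨hy.1, hy.2, h5, not_le.1 h6, not_le.1 h7⟩))
  simp only [sum_add_distrib] at h4
  omega

/-- If `v ∈ I` and `I` is triple-free, then `I` is independent in the link of `v`, so links of
picked vertices can be added to `G`. Each pick adds at least `θ₁` to the degree sum; once this
reaches `M`, the graph lemma finishes with `k₂` picks. If no pick is possible, `I` lies among the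
vertices with few new pairs, and the abundance of triples makes this set smaller than `A` by `δ`. -/
lemma certified_shrinks_of_links (hT : IsLinearTriples T d) (hK : 0 < K) {δ θ₁ θ₂ M : ℝ}
    (hθ₁ : 0 < θ₁) (hθ₂ : 0 < θ₂) (hd : 0 < d) (hM : 3 * K * δ + θ₂ * #A ≤ M)
    (ht : d * δ + θ₁ * #A + M + 2 * (d * (M / K)) ≤ tripleCount T A)
    (k₂ : ℕ) (hk₂ : δ ≤ k₂ * θ₂) (k : ℕ) :
    ∀ G, IsBoundedGraph A K G → M ≤ (∑ u ∈ A, #(G u) : ℕ) + k * θ₁ →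
      Certified (k + k₂) {I | (I ⊆ A ∧ TripleFree T I) ∧ ∀ v ∈ I, Disjoint I (G v)}
        (Shrinks A δ) := by
  have done : ∀ j G, IsBoundedGraph A K G → M ≤ (∑ u ∈ A, #(G u) : ℕ) →
      Certified (j + k₂) {I | (I ⊆ A ∧ TripleFree T I) ∧ ∀ v ∈ I, Disjoint I (G v)}
        (Shrinks A δ) := fun j G hG h =>
    (certified_shrinks_of_graph G A K hG.symm hG.card_le hK hG.subset hθ₂ hM h k₂ A
      Subset.rfl (by linarith)).mono (by omega) (fun I hI => ⟨hI.1.1, hI.2⟩) fun _ _ _ h => h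
  induction k with
  | zero =>
    intro G hG h
    exact done 0 G hG (by simpa using h)
  | succ k ih =>
    intro G hG h
    by_cases hlt : M ≤ (∑ u ∈ A, #(G u) : ℕ)
    · exact done _ G hG hlt
    rw [Nat.add_right_comm]
    refine certified_pick (fun v => θ₁ ≤ #(newPairs T A K G v)) (fun v hv => ?_) ?_
    · refine (ih (addLink T A K G v) (hG.addLink hT v) ?_).mono le_rfl ?_ fun _ _ _ h => h
      · rw [sum_card_addLink]
        push_cast at h ⊢
        linarith
      · rintro I ⟨⟨⟨hIA, hI⟩, hdis⟩, hvI⟩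
        refine ⟨⟨hIA, hI⟩, fun u hu => ?_⟩
        rw [addLink, disjoint_union_right]
        refine ⟨hdis u hu, disjoint_left.2 fun w hw hw' => ?_⟩
        exact hI v hvI u hu w hw (mem_filter.1 hw').2.2.1
    · refine certified_const {v ∈ A | (#(newPairs T A K G v) : ℝ) < θ₁} ?_
      rintro I ⟨⟨⟨hIA, hI⟩, -⟩, hq⟩
      refine ⟨fun v hv => mem_filter.2 ⟨hIA hv, not_le.1 (hq v hv)⟩, filter_subset _ _, ?_⟩
      have h1 : (tripleCount T A : ℝ) ≤ (∑ v ∈ A, #(newPairs T A K G v) : ℕ) +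
          (∑ u ∈ A, #(G u) : ℕ) + 2 * (d * #{u ∈ A | K ≤ #(G u)}) := by
        exact_mod_cast tripleCount_le hT hG.subset
      have h2 : (K : ℝ) * #{u ∈ A | K ≤ #(G u)} ≤ (∑ u ∈ A, #(G u) : ℕ) := by
        exact_mod_cast card_saturated_mul_le A K G
      have h3 := sum_le_of_le_of_lt A (fun v => #(newPairs T A K G v)) d θ₁ hθ₁.le
        fun v _ => (card_le_card fun y hy => by
          simp only [newPairs, mem_filter, mem_univ, true_and] at hy ⊢
          exact hy.2.1).trans (hT.degree_le v)
      have hK' : (0 : ℝ) < K := by exact_mod_cast hK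
      have hd' : (0 : ℝ) < d := by exact_mod_cast hd
      have h4 : (#{u ∈ A | K ≤ #(G u)} : ℝ) ≤ M / K := by
        rw [le_div_iff₀ hK', mul_comm]
        linarith
      have h5 : (d : ℝ) * #{u ∈ A | K ≤ #(G u)} ≤ d * (M / K) := by gcongr
      have h6 : (d : ℝ) * δ ≤ d * (#A - #{v ∈ A | (#(newPairs T A K G v) : ℝ) < θ₁}) := by
        linarith
      have := le_of_mul_le_mul_left h6 hd'
      linarith

/-- A container lemma for linear triple systems: every triple-free set has a container with few
triples, determined by few of its elements. -/
theorem certified_container (hT : IsLinearTriples T d) (hK : 0 < K) {δ θ₁ θ₂ M τ : ℝ}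
    (hθ₁ : 0 < θ₁) (hθ₂ : 0 < θ₂) (hτ : 0 < τ) (hd : 0 < d)
    (hM : 3 * K * δ + θ₂ * Fintype.card V ≤ M)
    (ht : d * δ + θ₁ * Fintype.card V + M + 2 * (d * (M / K)) ≤ τ)
    (k₁ k₂ : ℕ) (hk₁ : M ≤ k₁ * θ₁) (hk₂ : δ ≤ k₂ * θ₂) (j : ℕ) :
    ∀ A : Finset V, (#A : ℝ) ≤ j * δ →
      Certified (j * (k₁ + k₂)) {I | I ⊆ A ∧ TripleFree T I}
        (fun I A' => I ⊆ A' ∧ A' ⊆ A ∧ (tripleCount T A' : ℝ) < τ) := by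
  have done : ∀ (s : ℕ) (A : Finset V), (tripleCount T A : ℝ) < τ →
      Certified s {I | I ⊆ A ∧ TripleFree T I}
        (fun I A' => I ⊆ A' ∧ A' ⊆ A ∧ (tripleCount T A' : ℝ) < τ) := fun s A h =>
    certified_const A fun I hI => ⟨hI.1, Subset.rfl, h⟩
  induction j with
  | zero =>
    intro A hA
    refine done _ A ?_
    have : A = ∅ := by
      rw [← card_eq_zero]
      exact_mod_cast le_antisymm (by simpa using hA) (Nat.cast_nonneg (α := ℝ) #A)
    simpa [this, tripleCount] using hτ
  | succ j ih =>
    intro A hA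
    by_cases hlt : (tripleCount T A : ℝ) < τ
    · exact done _ A hlt
    have hcard : (#A : ℝ) ≤ Fintype.card V := by exact_mod_cast card_le_univ A
    have h1 : θ₁ * #A ≤ θ₁ * Fintype.card V := by gcongr
    have h2 : θ₂ * #A ≤ θ₂ * Fintype.card V := by gcongr
    have h3 := certified_shrinks_of_links (A := A) (δ := δ) (M := M) hT hK hθ₁ hθ₂ hd (by linarith)
      -- The process starts from the empty graph, in which every set is independent.
      (by linarith) k₂ hk₂ k₁ (fun _ => ∅) ⟨by simp, by simp, by simp⟩ (by simpa using hk₁)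
    have h4 : Certified (k₁ + k₂) {I | I ⊆ A ∧ TripleFree T I} (Shrinks A δ) :=
      h3.mono le_rfl (fun I hI => ⟨hI, by simp⟩) fun _ _ _ h => h
    rw [Nat.succ_mul, Nat.add_comm]
    refine h4.bind fun A' => ?_
    by_cases hA' : A' ⊆ A ∧ (#A' : ℝ) + δ ≤ #A
    · refine (ih A' ?_).mono le_rfl ?_ ?_
      · push_cast at hA; linarith
      · rintro I ⟨⟨-, hI⟩, h, -⟩
        exact ⟨h, hI⟩
      · rintro I - B ⟨h5, h6, h7⟩
        exact ⟨h5, h6.trans hA'.1, h7⟩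
    -- No `I` has this `A'` as its value, so the class is empty and any constant serves.
    · exact certified_const ∅ fun I hI => absurd ⟨hI.2.2.1, hI.2.2.2⟩ hA'

end LinkGraph

/-! ### Triangles as a linear triple system. -/

section Triangles

open Finset
open scoped Classical

/-- The relation of being the three edges of a triangle. -/
def EdgeTriple {α : Type*} (e f g : Sym2 α) : Prop :=
  ∃ a b c, a ≠ b ∧ a ≠ c ∧ b ≠ c ∧ e = s(a, b) ∧ f = s(a, c) ∧ g = s(b, c)

lemma isLinearTriples_edgeTriple (n : ℕ) :
    IsLinearTriples (EdgeTriple (α := Fin n)) (2 * n) where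
  swap_left := by
    rintro _ _ _ ⟨a, b, c, hab, hac, hbc, rfl, rfl, rfl⟩
    exact ⟨a, c, b, hac, hab, hbc.symm, rfl, rfl, Sym2.eq_swap⟩
  swap_right := by
    rintro _ _ _ ⟨a, b, c, hab, hac, hbc, rfl, rfl, rfl⟩
    exact ⟨b, a, c, hab.symm, hbc, hac, Sym2.eq_swap, rfl, rfl⟩
  unique := by
    rintro _ _ _ _ ⟨a, b, c, hab, hac, hbc, rfl, rfl, rfl⟩
      ⟨a', b', c', hab', hac', hbc', h1, h2, rfl⟩
    rw [Sym2.eq_iff] at h1 h2 ⊢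
    grind
  degree_le := by
    intro e
    induction e using Sym2.ind with
    | _ a b =>
      -- A triple through an edge is fixed by the third vertex and the order of the other two edges,
      -- hence `2 * n`.
      let φ : Bool × Fin n → Sym2 (Fin n) × Sym2 (Fin n) := fun x =>
        if x.1 then (s(a, x.2), s(b, x.2)) else (s(b, x.2), s(a, x.2))
      calc _ ≤ #(univ.image φ) := card_le_card ?_
        _ ≤ #(univ : Finset (Bool × Fin n)) := card_image_le
        _ = 2 * n := by simp
      rintro ⟨f, g⟩ h
      simp only [mem_filter, mem_univ, true_and] at h
      obtain ⟨a', b', c, -, -, -, h, rfl, rfl⟩ := h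
      rw [Sym2.eq_iff] at h
      rcases h with ⟨rfl, rfl⟩ | ⟨rfl, rfl⟩
      · exact mem_image.2 ⟨(true, c), mem_univ _, by simp [φ]⟩
      · exact mem_image.2 ⟨(false, c), mem_univ _, by simp [φ]⟩

lemma tripleFree_of_cliqueFree {α : Type*} {F : SimpleGraph α} (hF : F.CliqueFree 3)
    {I : Finset (Sym2 α)} (hI : ∀ e ∈ I, e ∈ F.edgeSet) : TripleFree EdgeTriple I := by
  rintro _ he _ hf _ hg ⟨a, b, c, -, -, -, rfl, rfl, rfl⟩
  exact hF {a, b, c} (SimpleGraph.is3Clique_triple_iff.2 ⟨hI _ he, hI _ hf, hI _ hg⟩)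

lemma card_cliqueFinset_le_tripleCount {α : Type*} [Fintype α] [DecidableEq α] (H : SimpleGraph α)
    {A : Finset (Sym2 α)} (hA : ∀ e, e ∈ H.edgeSet → e ∈ A) :
    #(H.cliqueFinset 3) ≤ tripleCount EdgeTriple A := by
  have h1 : ∀ t ∈ H.cliqueFinset 3, ∃ x : Σ _ : Sym2 α, Sym2 α × Sym2 α,
      x ∈ A.sigma (fun v => {y ∈ A ×ˢ A | EdgeTriple v y.1 y.2}) ∧
        t = x.1.toFinset ∪ x.2.1.toFinset := by
    intro t ht
    obtain ⟨a, b, c, hab, hac, hbc, rfl⟩ :=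
      SimpleGraph.is3Clique_iff.1 (SimpleGraph.mem_cliqueFinset_iff.1 ht)
    refine ⟨⟨s(a, b), s(a, c), s(b, c)⟩, ?_, ?_⟩
    · simp only [mem_sigma, mem_filter, mem_product]
      exact ⟨hA _ hab, ⟨hA _ hac, hA _ hbc⟩, a, b, c, hab.ne, hac.ne, hbc.ne, rfl, rfl, rfl⟩
    · ext x
      simp only [mem_insert, mem_singleton, mem_union, Sym2.mem_toFinset, Sym2.mem_iff]
      tauto
  rw [tripleCount, ← card_sigma]
  refine le_trans (card_le_card fun t ht => ?_) (card_image_le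
    (f := fun x : Σ _ : Sym2 α, Sym2 α × Sym2 α => x.1.toFinset ∪ x.2.1.toFinset))
  obtain ⟨x, hx, rfl⟩ := h1 t ht
  exact mem_image_of_mem _ hx

theorem certified_graph_container {γ : ℝ} (hγ : 0 < γ) :
    ∃ c : ℝ, 0 < c ∧ ∀ n : ℕ, 0 < n → ∃ s : ℕ, (s : ℝ) ≤ c * (n * √n) ∧
      Certified s {I : Finset (Sym2 (Fin n)) | (∀ e ∈ I, ¬ e.IsDiag) ∧ TripleFree EdgeTriple I}
        (fun I A => I ⊆ A ∧ (∀ e ∈ A, ¬ e.IsDiag) ∧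
          (tripleCount EdgeTriple A : ℝ) < γ * n ^ 3) := by
  refine ⟨4 * (⌈40 / γ⌉₊ + 1), by positivity, fun n hn => ?_⟩
  set j := ⌈40 / γ⌉₊
  -- Building the graph takes about `nK` picks and using it about `n²/K`; `K ≈ √n` balances them.
  -- Each round removes `γn²/40` pairs, so `j` rounds suffice.
  set K := ⌈√(n : ℝ)⌉₊ with hKdef
  have hn1 : (1 : ℝ) ≤ n := by exact_mod_cast hn
  have hs1 : 1 ≤ √(n : ℝ) := Real.one_le_sqrt.2 hn1
  have hK1 : √(n : ℝ) ≤ K := Nat.le_ceil _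
  have hK2 : (K : ℝ) ≤ 2 * √n := by
    have := Nat.ceil_lt_add_one (Real.sqrt_nonneg (n : ℝ))
    rw [← hKdef] at this
    linarith
  have hsq : √(n : ℝ) * √n = n := Real.mul_self_sqrt (by positivity)
  have hK3 : (K : ℝ) ≤ 2 * n := by nlinarith
  have hK4 : (n : ℝ) ≤ K * K := by nlinarith
  have hK : 0 < K := Nat.ceil_pos.2 (by positivity)
  have hK' : (0 : ℝ) < K := by exact_mod_cast hK
  have hV : (Fintype.card (Sym2 (Fin n)) : ℝ) ≤ n ^ 2 := by
    have : Fintype.card (Sym2 (Fin n)) ≤ n ^ 2 := by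
      rw [Sym2.card, Fintype.card_fin, Nat.choose_two_right, Nat.add_sub_cancel]
      exact Nat.div_le_of_le_mul (by nlinarith)
    exact_mod_cast this
  refine ⟨j * (n * K + n * K), ?_, ?_⟩
  · push_cast
    have : (n : ℝ) * K ≤ n * (2 * √n) := by gcongr
    calc (j : ℝ) * (n * K + n * K) ≤ j * (n * (2 * √n) + n * (2 * √n)) := by gcongr
      _ = 4 * j * (n * √n) := by ring
      _ ≤ 4 * (j + 1) * (n * √n) := by gcongr; linarith
  · have key := certified_container (V := Sym2 (Fin n)) (K := K)
      (isLinearTriples_edgeTriple n) hK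
      (δ := γ / 40 * n ^ 2) (θ₁ := γ / 4 * n) (θ₂ := γ / 40 * K) (M := γ / 10 * (n ^ 2 * K))
      (τ := γ * n ^ 3) (by positivity) (by positivity) (by positivity) (by positivity)
      (by
        have : γ / 40 * K * (Fintype.card (Sym2 (Fin n)) : ℝ) ≤ γ / 40 * K * n ^ 2 := by gcongr
        linarith)
      (by
        have h1 : γ / 4 * n * (Fintype.card (Sym2 (Fin n)) : ℝ) ≤ γ / 4 * n * n ^ 2 := by gcongr
        have h2 : γ / 10 * ((n : ℝ) ^ 2 * K) ≤ γ / 10 * (n ^ 2 * (2 * n)) := by gcongr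
        have h3 : γ / 10 * ((n : ℝ) ^ 2 * K) / K = γ / 10 * n ^ 2 := by field_simp
        rw [h3]
        push_cast
        have : 0 < γ * (n : ℝ) ^ 3 := by positivity
        nlinarith)
      (n * K) (n * K)
      (by
        push_cast
        have : 0 < γ * ((n : ℝ) ^ 2 * K) := by positivity
        nlinarith)
      (by
        push_cast
        have : γ / 40 * (n * (n : ℝ)) ≤ γ / 40 * (n * (K * K)) := by gcongr
        nlinarith)
      j ({e | ¬ e.IsDiag} : Finset (Sym2 (Fin n)))
      (by
        have h1 : 40 / γ ≤ j := Nat.le_ceil _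
        have h2 : (#({e | ¬ e.IsDiag} : Finset (Sym2 (Fin n))) : ℝ) ≤ n ^ 2 :=
          le_trans (by exact_mod_cast card_le_univ _) hV
        calc _ ≤ _ := h2
          _ = 40 / γ * (γ / 40 * (n : ℝ) ^ 2) := by field_simp
          _ ≤ j * (γ / 40 * (n : ℝ) ^ 2) := by gcongr)
    refine key.mono le_rfl (fun I hI => ⟨fun e he => by simpa using hI.1 e he, hI.2⟩) ?_
    rintro I - A ⟨h1, h2, h3⟩
    exact ⟨h1, fun e he => by simpa using h2 he, h3⟩

end Triangles

/-! ### Stability for graphs with few triangles. -/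

section Stability

open Finset
open scoped Classical

/-- Füredi's argument: the neighbourhood `N` of a vertex of maximum degree is independent, so
deleting the edges `D` inside `Nᶜ` leaves a bipartite graph. The degree sum over `Nᶜ` counts each
edge once and those of `D` twice, and is at most `|Nᶜ||N| ≤ n²/4`. -/
lemma SimpleGraph.CliqueFree.exists_isBipartite_deleteEdges {α : Type*} [Fintype α] [DecidableEq α]
    {H : SimpleGraph α} (hH : H.CliqueFree 3) :
    ∃ D ⊆ H.edgeFinset, (#D : ℝ) + #H.edgeFinset ≤ (Fintype.card α : ℝ) ^ 2 / 4 ∧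
      (H.deleteEdges (D : Set (Sym2 α))).IsBipartite := by
  rcases isEmpty_or_nonempty α with hα | hα
  · refine ⟨∅, empty_subset _, ?_, ?_⟩
    · simp [Finset.eq_empty_of_isEmpty]
    · exact SimpleGraph.Colorable.of_isEmpty _
  obtain ⟨v, hv⟩ := H.exists_maximal_degree_vertex
  set N := H.neighborFinset v with hN
  set D := {e ∈ H.edgeFinset | ∀ x ∈ e, x ∉ N} with hD
  refine ⟨D, filter_subset _ _, ?_, ?_⟩
  · have h1 : ∑ b ∈ Nᶜ, H.degree b =
        ∑ e ∈ H.edgeFinset, #{b ∈ Nᶜ | b ∈ e} := by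
      calc ∑ b ∈ Nᶜ, H.degree b
          = ∑ b ∈ Nᶜ, #(bipartiteAbove (fun b (e : Sym2 α) => b ∈ e) H.edgeFinset b) := by
            refine sum_congr rfl fun b _ => ?_
            rw [← H.card_incidenceFinset_eq_degree, H.incidenceFinset_eq_filter]
            rfl
        _ = _ := sum_card_bipartiteAbove_eq_sum_card_bipartiteBelow _
    have h2 : ∀ e ∈ H.edgeFinset, 1 + (if e ∈ D then 1 else 0) ≤ #{b ∈ Nᶜ | b ∈ e} := by
      intro e he
      induction e using Sym2.ind with
      | _ a b =>
        have hab : H.Adj a b := by simpa using he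
        by_cases heD : s(a, b) ∈ D
        · rw [if_pos heD]
          have h3 : ∀ x ∈ s(a, b), x ∉ N := (mem_filter.1 heD).2
          have h4 : ({a, b} : Finset α) ⊆ {x ∈ Nᶜ | x ∈ s(a, b)} := by
            intro x hx
            have hx' : x ∈ s(a, b) := by simpa using hx
            exact mem_filter.2 ⟨mem_compl.2 (h3 x hx'), hx'⟩
          exact (card_pair hab.ne).symm.le.trans (card_le_card h4)
        · rw [if_neg heD, add_zero, Nat.one_le_iff_ne_zero, card_ne_zero]
          by_cases ha : a ∈ N
          · refine ⟨b, mem_filter.2 ⟨mem_compl.2 fun hb => ?_, by simp⟩⟩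
            rw [hN, SimpleGraph.mem_neighborFinset] at ha hb
            exact hH {v, a, b} (SimpleGraph.is3Clique_triple_iff.2 ⟨ha, hb, hab⟩)
          · exact ⟨a, mem_filter.2 ⟨mem_compl.2 ha, by simp⟩⟩
    have h3 : #H.edgeFinset + #D ≤ ∑ b ∈ Nᶜ, H.degree b := by
      rw [h1]
      refine le_trans ?_ (sum_le_sum h2)
      rw [sum_add_distrib, sum_boole, sum_const, smul_eq_mul, mul_one]
      simp only [Nat.cast_id, add_le_add_iff_left]
      exact card_le_card fun e he => mem_filter.2 ⟨(mem_filter.1 he).1, he⟩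
    have h4 : ∑ b ∈ Nᶜ, H.degree b ≤ #Nᶜ * #N := by
      calc ∑ b ∈ Nᶜ, H.degree b ≤ ∑ b ∈ Nᶜ, #N := sum_le_sum fun b _ => by
            rw [hN, H.card_neighborFinset_eq_degree, ← hv]
            exact H.degree_le_maxDegree b
        _ = #Nᶜ * #N := by simp
    have h5 : (#D : ℝ) + #H.edgeFinset ≤ #Nᶜ * #N := by
      rw [add_comm]
      exact_mod_cast h3.trans h4
    have h6 : (#N : ℝ) + #Nᶜ = Fintype.card α := by exact_mod_cast card_add_card_compl N
    rw [← h6]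
    nlinarith [sq_nonneg ((#N : ℝ) - #Nᶜ)]
  · refine ⟨SimpleGraph.Coloring.mk (fun x => if x ∈ N then (0 : Fin 2) else 1) ?_⟩
    intro a b hab
    rw [SimpleGraph.deleteEdges_adj] at hab
    obtain ⟨hab, hD'⟩ := hab
    by_cases ha : a ∈ N <;> by_cases hb : b ∈ N
    · rw [hN, SimpleGraph.mem_neighborFinset] at ha hb
      exact absurd (SimpleGraph.is3Clique_triple_iff.2 ⟨ha, hb, hab⟩) (hH {v, a, b})
    · simp [ha, hb]
    · simp [ha, hb]
    · refine absurd ?_ hD'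
      rw [mem_coe, hD, mem_filter]
      refine ⟨by simpa using hab, fun x hx => ?_⟩
      rcases Sym2.mem_iff.1 hx with rfl | rfl <;> assumption

/-- Triangle removal deletes at most `ηn²/4` edges. These count twice, once as deletions and once as
a loss of density in Füredi's bound, and the density deficit adds `ηn²/4`: in all `3ηn²/4`. -/
theorem exists_isBipartite_deleteEdges_of_card_cliqueFinset_lt {α : Type*} [Fintype α] [DecidableEq α]
    {H : SimpleGraph α} {η : ℝ}
    (ht : #(H.cliqueFinset 3) < SimpleGraph.triangleRemovalBound (η / 4) * Fintype.card α ^ 3)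
    (he : (1 - η) * (Fintype.card α : ℝ) ^ 2 / 4 ≤ #H.edgeFinset) :
    ∃ D ⊆ H.edgeFinset, (#D : ℝ) ≤ η * (Fintype.card α : ℝ) ^ 2 ∧
      (H.deleteEdges (D : Set (Sym2 α))).IsBipartite := by
  obtain ⟨G', hle, _, hcard, hfree⟩ := SimpleGraph.triangle_removal ht
  obtain ⟨D, hD, hDcard, hbip⟩ := hfree.exists_isBipartite_deleteEdges
  have hsub : G'.edgeFinset ⊆ H.edgeFinset := SimpleGraph.edgeFinset_mono hle
  refine ⟨(H.edgeFinset \ G'.edgeFinset) ∪ D, ?_, ?_, hbip.mono_left ?_⟩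
  · refine union_subset sdiff_subset (hD.trans ?_)
    convert hsub
  · have h1 : (#(H.edgeFinset \ G'.edgeFinset) : ℝ) = #H.edgeFinset - #G'.edgeFinset := by
      rw [card_sdiff_of_subset hsub, Nat.cast_sub (card_le_card hsub)]
    have h2 : (#((H.edgeFinset \ G'.edgeFinset) ∪ D) : ℝ) ≤
        #(H.edgeFinset \ G'.edgeFinset) + #D := by exact_mod_cast card_union_le _ _
    have h3 : (#D : ℝ) + #G'.edgeFinset ≤ (Fintype.card α : ℝ) ^ 2 / 4 := by
      convert hDcard
    push_cast at hcard
    linarith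
  · intro a b hab
    rw [SimpleGraph.deleteEdges_adj] at hab ⊢
    simp only [coe_union, coe_sdiff, SimpleGraph.coe_edgeFinset, Set.mem_union, Set.mem_sdiff,
      SimpleGraph.mem_edgeSet, not_or, not_and, not_not] at hab
    exact ⟨hab.2.1 hab.1, hab.2.2⟩

end Stability

/-! ### Exponential moments and the union bound over fingerprints. -/

section Probability

open Finset
open scoped Classical

/-- Since `#S ≤ s`, `y ^ #S ≤ x ^ s * (y / x) ^ #S`, and the binomial theorem sums the rest. A large
constant `x` makes the exponential cheap at the price `x ^ s`. -/
lemma sum_pow_card_le {β : Type*} (U : Finset β) (s : ℕ) {x y : ℝ} (hx : 1 ≤ x) (hy : 0 ≤ y) :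
    ∑ S ∈ U.powerset with #S ≤ s, y ^ #S ≤ x ^ s * Real.exp (#U * (y / x)) := by
  have hx0 : 0 < x := by linarith
  calc ∑ S ∈ U.powerset with #S ≤ s, y ^ #S
      ≤ ∑ S ∈ U.powerset with #S ≤ s, x ^ s * (y / x) ^ #S := by
        refine sum_le_sum fun S hS => ?_
        have h1 : x ^ #S ≤ x ^ s := pow_le_pow_right₀ hx (mem_filter.1 hS).2
        calc y ^ #S = x ^ #S * (y / x) ^ #S := by rw [← mul_pow, mul_div_cancel₀ _ hx0.ne']
          _ ≤ _ := by gcongr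
    _ ≤ ∑ S ∈ U.powerset, x ^ s * (y / x) ^ #S :=
        sum_le_sum_of_subset_of_nonneg (filter_subset _ _) fun _ _ _ => by positivity
    _ = x ^ s * (y / x + 1) ^ #U := by
        rw [← mul_sum, ← sum_pow_mul_eq_add_pow]
        simp
    _ ≤ x ^ s * Real.exp (y / x) ^ #U := by
        gcongr
        exact Real.add_one_le_exp _
    _ = _ := by rw [← Real.exp_nat_mul]

/-- The sum factorises over `U`. Elements of `S` are charged `z * p` whether or not they lie in `B`;
the others in `B` contribute `1 + p(z - 1)`, at most its exponential. -/
lemma sum_powerset_weight_le {β : Type*} [DecidableEq β] (U S B : Finset β) (hS : S ⊆ U) {p z : ℝ} (hp : 0 ≤ p)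
    (hp1 : p ≤ 1) (hz : 1 ≤ z) :
    ∑ E ∈ U.powerset with S ⊆ E, z ^ #(E ∩ B) * (p ^ #E * (1 - p) ^ (#U - #E)) ≤
      (z * p) ^ #S * Real.exp (p * (z - 1) * #B) := by
  have hq : 0 ≤ 1 - p := by linarith
  have hz0 : 0 ≤ z - 1 := by linarith
  calc ∑ E ∈ U.powerset with S ⊆ E, z ^ #(E ∩ B) * (p ^ #E * (1 - p) ^ (#U - #E))
      ≤ ∑ E ∈ U.powerset, (∏ i ∈ E, p * (if i ∈ B then z else 1)) *
          ∏ i ∈ U \ E, (if i ∈ S then 0 else 1 - p) := by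
        rw [sum_filter]
        refine sum_le_sum fun E hE => ?_
        rw [mem_powerset] at hE
        split_ifs with hSE
        · have h1 : ∏ i ∈ U \ E, (if i ∈ S then 0 else 1 - p) = (1 - p) ^ (#U - #E) := by
            rw [← card_sdiff_of_subset hE, ← prod_const]
            refine prod_congr rfl fun i hi => if_neg fun hiS => ?_
            exact (Finset.mem_sdiff.1 hi).2 (hSE hiS)
          have h2 : ∏ i ∈ E, (if i ∈ B then z else 1) = z ^ #(E ∩ B) := by
            rw [prod_ite_mem, prod_const]
          rw [h1, prod_mul_distrib, prod_const, h2]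
          exact le_of_eq (by ring)
        · refine mul_nonneg (prod_nonneg fun i _ => ?_) (prod_nonneg fun i _ => ?_)
          · split_ifs <;> nlinarith
          · split_ifs <;> linarith
    _ = ∏ i ∈ U, (p * (if i ∈ B then z else 1) + (if i ∈ S then 0 else 1 - p)) :=
        (prod_add _ _ _).symm
    _ ≤ ∏ i ∈ U, (if i ∈ S then z * p else 1) *
          (if i ∈ B then Real.exp (p * (z - 1)) else 1) := by
        have hexp := Real.add_one_le_exp (p * (z - 1))
        have hpz : 0 ≤ p * (z - 1) := mul_nonneg hp hz0
        refine prod_le_prod (fun i _ => ?_) fun i _ => ?_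
        · split_ifs <;> nlinarith
        · split_ifs <;> nlinarith
    _ = (z * p) ^ #S * Real.exp (p * (z - 1)) ^ #(U ∩ B) := by
        rw [prod_mul_distrib, prod_ite_mem, prod_ite_mem, prod_const, prod_const,
          inter_eq_right.2 hS]
    _ ≤ (z * p) ^ #S * Real.exp (p * (z - 1)) ^ #B := by
        gcongr
        · exact Real.one_le_exp (mul_nonneg hp hz0)
        · exact inter_subset_right
    _ = _ := by
        rw [← Real.exp_nat_mul]
        ring_nf

instance SimpleGraph.measurableSingletonClass {α : Type*} [Countable α] :
    MeasurableSingletonClass (SimpleGraph α) where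
  measurableSet_singleton G := by
    have h : ({G} : Set (SimpleGraph α)) = SimpleGraph.edgeSet ⁻¹' {G.edgeSet} := by
      ext H
      simp
    rw [h]
    exact SimpleGraph.measurable_edgeSet (MeasurableSet.singleton _)

lemma binomialRandom_real_singleton {n : ℕ} (p : unitInterval) (G : SimpleGraph (Fin n)) :
    (SimpleGraph.binomialRandom (Fin n) p).real {G} =
      (p : ℝ) ^ #G.edgeFinset *
        (1 - (p : ℝ)) ^ (#({e | ¬ e.IsDiag} : Finset (Sym2 (Fin n))) - #G.edgeFinset) := by
  have h : #({e | ¬ e.IsDiag} : Finset (Sym2 (Fin n))) = n.choose 2 := by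
    rw [← Fintype.card_subtype, Sym2.card_subtype_not_diag, Fintype.card_fin]
  rw [MeasureTheory.measureReal_def, SimpleGraph.binomialRandom_singleton, h]
  simp only [Nat.card_eq_fintype_card, Fintype.card_fin, ENNReal.toReal_mul, ENNReal.toReal_pow,
    ENNReal.coe_toReal, Set.ncard_eq_toFinset_card', SimpleGraph.edgeFinset]
  simp

/-- Markov's inequality for `z ^ #(G ∩ B)` on the event `S ⊆ G`. Treating both conditions jointly
avoids removing `S` from `B`, and the factor `p ^ #S` pays for the union bound. -/
lemma binomialRandom_real_le {n : ℕ} (p : unitInterval) {z : ℝ} (hz : 1 ≤ z)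
    (S B : Finset (Sym2 (Fin n))) (hS : ∀ e ∈ S, ¬ e.IsDiag) (m : ℝ) :
    (SimpleGraph.binomialRandom (Fin n) p).real
        {G | S ⊆ G.edgeFinset ∧ m ≤ #(G.edgeFinset ∩ B)} ≤
      (z * p) ^ #S * Real.exp ((p : ℝ) * (z - 1) * #B - m * Real.log z) := by
  set U : Finset (Sym2 (Fin n)) := {e | ¬ e.IsDiag} with hU
  have hz0 : 0 < z := by linarith
  have hq : 0 ≤ 1 - (p : ℝ) := by linarith [p.2.2]
  have hp : 0 ≤ (p : ℝ) := p.2.1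
  set f : Finset (Sym2 (Fin n)) → ℝ := fun E =>
    z ^ #(E ∩ B) * ((p : ℝ) ^ #E * (1 - (p : ℝ)) ^ (#U - #E)) with hf
  have h1 : ∑ G : SimpleGraph (Fin n) with S ⊆ G.edgeFinset ∧ m ≤ #(G.edgeFinset ∩ B),
      f G.edgeFinset ≤ ∑ E ∈ U.powerset with S ⊆ E, f E := by
    rw [← sum_image (s := {G : SimpleGraph (Fin n) |
      S ⊆ G.edgeFinset ∧ m ≤ #(G.edgeFinset ∩ B)}) (g := fun G => G.edgeFinset) (f := f)]
    · refine sum_le_sum_of_subset_of_nonneg ?_ fun _ _ _ => by positivity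
      intro E hE
      obtain ⟨G, hG, rfl⟩ := mem_image.1 hE
      refine mem_filter.2 ⟨mem_powerset.2 fun e he => ?_, (mem_filter.1 hG).2.1⟩
      rw [hU, mem_filter]
      exact ⟨mem_univ _, G.not_isDiag_of_mem_edgeFinset he⟩
    · intro G _ G' _ h
      exact SimpleGraph.edgeFinset_inj.1 h
  have h2 := sum_powerset_weight_le U S B (fun e he => by simp [hU, hS e he]) hp p.2.2 hz
  have h3 : (SimpleGraph.binomialRandom (Fin n) p).real
        {G | S ⊆ G.edgeFinset ∧ m ≤ #(G.edgeFinset ∩ B)} ≤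
      ∑ G : SimpleGraph (Fin n) with S ⊆ G.edgeFinset ∧ m ≤ #(G.edgeFinset ∩ B),
        f G.edgeFinset * Real.exp (-(m * Real.log z)) := by
    calc _ = (SimpleGraph.binomialRandom (Fin n) p).real
          (({G | S ⊆ G.edgeFinset ∧ m ≤ #(G.edgeFinset ∩ B)} :
            Finset (SimpleGraph (Fin n))) : Set (SimpleGraph (Fin n))) := by
          congr 1
          ext G
          simp
      _ = ∑ G : SimpleGraph (Fin n) with S ⊆ G.edgeFinset ∧ m ≤ #(G.edgeFinset ∩ B),
          (SimpleGraph.binomialRandom (Fin n) p).real {G} :=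
          (MeasureTheory.sum_measureReal_singleton _).symm
      _ ≤ _ := by
          refine sum_le_sum fun G hG => ?_
          rw [binomialRandom_real_singleton]
          have h4 : 1 ≤ z ^ #(G.edgeFinset ∩ B) * Real.exp (-(m * Real.log z)) := by
            rw [← Real.rpow_natCast, Real.rpow_def_of_pos hz0, ← Real.exp_add]
            refine Real.one_le_exp ?_
            have := mul_le_mul_of_nonneg_right (mem_filter.1 hG).2.2 (Real.log_nonneg hz)
            linarith
          have h5 : 0 ≤ (p : ℝ) ^ #G.edgeFinset * (1 - (p : ℝ)) ^ (#U - #G.edgeFinset) := by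
            positivity
          calc _ ≤ ((p : ℝ) ^ #G.edgeFinset * (1 - (p : ℝ)) ^ (#U - #G.edgeFinset)) *
                (z ^ #(G.edgeFinset ∩ B) * Real.exp (-(m * Real.log z))) :=
                le_mul_of_one_le_right h5 h4
            _ = _ := by rw [hf]; ring
  calc _ ≤ _ := h3
    _ ≤ (z * p) ^ #S * Real.exp (p * (z - 1) * #B) * Real.exp (-(m * Real.log z)) := by
        rw [← sum_mul]
        gcongr
        exact h1.trans h2
    _ = _ := by rw [mul_assoc, ← Real.exp_add, ← sub_eq_add_neg]

lemma binomialRandom_real_exists_le {n : ℕ} (p : unitInterval) {z x R : ℝ} (hz : 1 ≤ z)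
    (hx : 1 ≤ x) (s : ℕ) (B : Finset (Sym2 (Fin n)) → Finset (Sym2 (Fin n)))
    (m : Finset (Sym2 (Fin n)) → ℝ)
    (hR : ∀ S, (p : ℝ) * (z - 1) * #(B S) - m S * Real.log z ≤ R) :
    (SimpleGraph.binomialRandom (Fin n) p).real
        {G | ∃ S, #S ≤ s ∧ S ⊆ G.edgeFinset ∧ m S ≤ #(G.edgeFinset ∩ B S)} ≤
      x ^ s * Real.exp ((n : ℝ) ^ 2 * (z * p / x)) * Real.exp R := by
  set U : Finset (Sym2 (Fin n)) := {e | ¬ e.IsDiag} with hU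
  have hp : 0 ≤ (p : ℝ) := p.2.1
  have hz0 : 0 < z := by linarith
  have hUcard : (#U : ℝ) ≤ (n : ℝ) ^ 2 := by
    have h : #U = n.choose 2 := by
      rw [hU, ← Fintype.card_subtype, Sym2.card_subtype_not_diag, Fintype.card_fin]
    rw [h]
    exact_mod_cast Nat.choose_le_pow n 2
  calc _ ≤ (SimpleGraph.binomialRandom (Fin n) p).real
        (⋃ S ∈ ({S ∈ U.powerset | #S ≤ s} : Finset (Finset (Sym2 (Fin n)))),
          {G | S ⊆ G.edgeFinset ∧ m S ≤ #(G.edgeFinset ∩ B S)}) := by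
        refine MeasureTheory.measureReal_mono ?_ (by simp)
        rintro G ⟨S, hs, hS, hm⟩
        simp only [Set.mem_iUnion]
        refine ⟨S, mem_filter.2 ⟨mem_powerset.2 fun e he => ?_, hs⟩, hS, hm⟩
        rw [hU, mem_filter]
        exact ⟨mem_univ _, G.not_isDiag_of_mem_edgeFinset (hS he)⟩
    _ ≤ ∑ S ∈ U.powerset with #S ≤ s, (SimpleGraph.binomialRandom (Fin n) p).real
          {G | S ⊆ G.edgeFinset ∧ m S ≤ #(G.edgeFinset ∩ B S)} :=
        MeasureTheory.measureReal_biUnion_finset_le _ _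
    _ ≤ ∑ S ∈ U.powerset with #S ≤ s, (z * p) ^ #S * Real.exp R := by
        refine sum_le_sum fun S hS => ?_
        refine (binomialRandom_real_le p hz S (B S) (fun e he => ?_) (m S)).trans ?_
        · have := mem_powerset.1 (mem_filter.1 hS).1 he
          simpa [hU] using this
        · gcongr
          exact hR S
    _ = (∑ S ∈ U.powerset with #S ≤ s, (z * p) ^ #S) * Real.exp R := by rw [sum_mul]
    _ ≤ x ^ s * Real.exp (#U * (z * p / x)) * Real.exp R := by
        gcongr
        exact sum_pow_card_le U s hx (by positivity)
    _ ≤ _ := by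
        have : 0 < x := by linarith
        gcongr

end Probability

/-! ### Containers against dense subgraphs far from bipartite. -/

section Bipartite

open Finset
open scoped Classical

/-- A graph container with few triples either has few edges or is nearly bipartite; in both cases
the edges of a dense triangle-free subgraph far from bipartite are concentrated on a set that is
too small for a random graph. -/
lemma exists_overfull_set {n : ℕ} {η p : ℝ} (hp : 0 ≤ p) (hη : 0 < η) (hη2 : η ≤ 1 / 2)
    (A : Finset (Sym2 (Fin n))) :
    ∃ (B : Finset (Sym2 (Fin n))) (m : ℝ), p * #B ≤ (1 - η / 2) * m ∧
      η / 8 * ((n : ℝ) ^ 2 * p) ≤ m ∧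
      ((∀ e ∈ A, ¬ e.IsDiag) →
        (tripleCount EdgeTriple A : ℝ) < SimpleGraph.triangleRemovalBound (η / 4) * n ^ 3 →
        ∀ F : SimpleGraph (Fin n), F.edgeFinset ⊆ A →
          (1 - η / 2) * (n : ℝ) ^ 2 * p / 4 ≤ #F.edgeFinset →
          (∀ D : Set (Sym2 (Fin n)), D ⊆ F.edgeSet → (F.deleteEdges D).IsBipartite →
            2 * η * (n : ℝ) ^ 2 * p < D.ncard) →
          m ≤ #(F.edgeFinset ∩ B)) := by
  have hL : 0 ≤ (n : ℝ) ^ 2 * p := by positivity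
  by_cases hA : (∀ e ∈ A, ¬ e.IsDiag) ∧
    (tripleCount EdgeTriple A : ℝ) < SimpleGraph.triangleRemovalBound (η / 4) * n ^ 3
  swap
  -- Not a usable container: the numerical bounds must still hold for every `A`, since the union
  -- bound runs over all `S`.
  · refine ⟨∅, η / 8 * ((n : ℝ) ^ 2 * p), ?_, le_rfl, fun h1 h2 => absurd ⟨h1, h2⟩ hA⟩
    simp only [card_empty, Nat.cast_zero, mul_zero]
    have : 0 ≤ 1 - η / 2 := by linarith
    positivity
  obtain ⟨hdiag, ht⟩ := hA
  by_cases hcard : (1 - η) * (n : ℝ) ^ 2 / 4 ≤ #A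
  · obtain ⟨H, hH⟩ : ∃ H : SimpleGraph (Fin n), H = .fromEdgeSet (A : Set (Sym2 (Fin n))) :=
      ⟨_, rfl⟩
    have hHA : H.edgeFinset = A := by
      ext e
      simp only [SimpleGraph.mem_edgeFinset, hH, SimpleGraph.edgeSet_fromEdgeSet, Set.mem_sdiff,
        mem_coe]
      exact ⟨fun h => h.1, fun h => ⟨h, hdiag e h⟩⟩
    have hcl : (#(H.cliqueFinset 3) : ℝ) <
        SimpleGraph.triangleRemovalBound (η / 4) * (Fintype.card (Fin n) : ℝ) ^ 3 := by
      rw [Fintype.card_fin]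
      refine lt_of_le_of_lt ?_ ht
      exact_mod_cast card_cliqueFinset_le_tripleCount H fun e he => by
        rw [← hHA, SimpleGraph.mem_edgeFinset]
        exact he
    obtain ⟨D, -, hDc, hbip⟩ := exists_isBipartite_deleteEdges_of_card_cliqueFinset_lt
      (H := H) hcl (by
        rw [Fintype.card_fin, hHA]
        exact hcard)
    rw [Fintype.card_fin] at hDc
    -- The container is nearly bipartite. Deleting `F ∩ D` makes `F` bipartite, so `F` has more than
    -- `2ηn²p` edges in `D`, about twice the expected number or more.
    refine ⟨D, 2 * η * ((n : ℝ) ^ 2 * p), ?_, by nlinarith, fun _ _ F hFA _ hF => ?_⟩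
    · have h1 : p * #D ≤ p * (η * (n : ℝ) ^ 2) := by gcongr
      have h2 : 0 ≤ η * ((n : ℝ) ^ 2 * p) := by positivity
      nlinarith
    · have h1 := hF (F.edgeFinset ∩ D : Finset (Sym2 (Fin n))) (fun e he => by
        simpa using (mem_inter.1 (mem_coe.1 he)).1) (hbip.mono_left (by
          intro a b hab
          rw [SimpleGraph.deleteEdges_adj] at hab ⊢
          have h3 : s(a, b) ∈ F.edgeFinset := by simpa using hab.1
          refine ⟨?_, fun h => hab.2 ?_⟩
          · rw [← SimpleGraph.mem_edgeSet, ← SimpleGraph.mem_edgeFinset, hHA]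
            exact hFA h3
          · exact mem_coe.2 (mem_inter.2 ⟨h3, mem_coe.1 h⟩)))
      rw [Set.ncard_coe_finset] at h1
      linarith
  -- The container is sparse: `F` itself overfills it, as `1 - η ≤ (1 - η/2)²`.
  · refine ⟨A, (1 - η / 2) * (n : ℝ) ^ 2 * p / 4, ?_, ?_, fun _ _ F hFA hF _ => ?_⟩
    · have h1 : p * #A ≤ p * ((1 - η) * (n : ℝ) ^ 2 / 4) := by
        gcongr
        exact (not_le.1 hcard).le
      nlinarith [mul_nonneg (sq_nonneg η) hL]
    · nlinarith
    · rw [inter_eq_left.2 hFA]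
      exact hF

end Bipartite

/-! ### The Chernoff exponent and passage to the limit. -/

section Asymptotics

lemma sub_sq_div_two_le_log {ε : ℝ} (hε : 0 ≤ ε) : ε - ε ^ 2 / 2 ≤ Real.log (1 + ε) := by
  refine le_trans ?_ (Real.le_log_one_add_of_nonneg hε)
  rw [le_div_iff₀ (by linarith)]
  nlinarith [pow_nonneg hε 3]

/-- With `z = 1 + ε`, the second-order bound on the logarithm gives at most `ε(1 - ε)m - (ε - ε²/2)m
= -ε²m/2`. -/
lemma chernoff_exponent_le {ε a m L c : ℝ} (hε : 0 ≤ ε) (ha : a ≤ (1 - ε) * m)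
    (hm : c * L ≤ m) (hcL : 0 ≤ c * L) :
    ε * a - m * Real.log (1 + ε) ≤ -(c * ε ^ 2 / 2 * L) := by
  have h1 := mul_le_mul_of_nonneg_left (sub_sq_div_two_le_log hε) (hcL.trans hm)
  have h2 := mul_le_mul_of_nonneg_left ha hε
  nlinarith [mul_le_mul_of_nonneg_left hm (sq_nonneg ε)]

lemma tendsto_measure_one_of_real_compl {Ω : ℕ → Type*} [∀ n, MeasurableSpace (Ω n)]
    (μ : ∀ n, MeasureTheory.Measure (Ω n)) [∀ n, MeasureTheory.IsProbabilityMeasure (μ n)]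
    (s : ∀ n, Set (Ω n)) (hs : ∀ n, MeasurableSet (s n))
    (h : Tendsto (fun n => (μ n).real (s n)ᶜ) atTop (𝓝 0)) :
    Tendsto (fun n => μ n (s n)) atTop (𝓝 1) := by
  have h1 : Tendsto (fun n => (μ n).real (s n)) atTop (𝓝 1) := by
    have h2 : ∀ n, (μ n).real (s n) = 1 - (μ n).real (s n)ᶜ := fun n => by
      rw [MeasureTheory.probReal_compl_eq_one_sub (hs n)]
      ring
    simp only [h2]
    simpa using h.const_sub 1
  rw [← ENNReal.tendsto_toReal_iff (fun n => MeasureTheory.measure_ne_top _ _) (by simp)]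
  simpa [MeasureTheory.measureReal_def] using h1

end Asymptotics

/-! ### The quantitative bound and the theorem. -/

open scoped Classical in
theorem exists_real_compl_le (η : ℝ) (hη : 0 < η) (hη2 : η ≤ 1 / 2) :
    ∃ a : ℝ, 0 < a ∧ ∃ C : ℝ, 1 ≤ C ∧ ∀ (n : ℕ) (p : unitInterval), 0 < n →
      C * (n * √n) ≤ (n : ℝ) ^ 2 * p →
      (SimpleGraph.binomialRandom (Fin n) p).real
        {G : SimpleGraph (Fin n) |
          ∀ F : SimpleGraph (Fin n), F ≤ G → F.CliqueFree 3 →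
            (1 - η / 2) * (n : ℝ) ^ 2 * (p : ℝ) / 4 ≤ (F.edgeSet.ncard : ℝ) →
            ∃ D : Set (Sym2 (Fin n)), D ⊆ F.edgeSet ∧
              (D.ncard : ℝ) ≤ 2 * η * (n : ℝ) ^ 2 * (p : ℝ) ∧
              (F.deleteEdges D).IsBipartite}ᶜ ≤ Real.exp (-(a * ((n : ℝ) ^ 2 * p))) := by
  obtain ⟨c, hc, hcont⟩ := certified_graph_container
    (SimpleGraph.triangleRemovalBound_pos (show 0 < η / 4 by positivity))
  set b : ℝ := η / 8 * (η / 2) ^ 2 / 2 with hb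
  have hb0 : 0 < b := by positivity
  -- Here `x` makes the exponential factor of the union bound at most `exp(bL/4)`; then `C` makes `x
  -- ^ s ≤ exp(bL/4)`. Against `exp(-bL)` this leaves `exp(-bL/2)`.
  set x : ℝ := 8 / b + 1 with hx
  have hx1 : 1 ≤ x := by
    have : 0 < 8 / b := by positivity
    linarith
  have hlog : 0 ≤ Real.log x := Real.log_nonneg hx1
  refine ⟨b / 2, by positivity, 4 * c * Real.log x / b + 1, ?_, fun n p hn hC => ?_⟩
  · have : 0 ≤ 4 * c * Real.log x / b := by positivity
    linarith
  set L : ℝ := (n : ℝ) ^ 2 * p with hL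
  have hp : 0 ≤ (p : ℝ) := p.2.1
  have hL0 : 0 ≤ L := by positivity
  obtain ⟨s, hs, h, hh⟩ := hcont n hn
  choose B m h1 h2 h3 using fun A => exists_overfull_set hp hη hη2 (n := n) A
  have hbound := binomialRandom_real_exists_le p (z := 1 + η / 2) (x := x) (by linarith) hx1 s
    (fun S => B (h S)) (fun S => m (h S)) (R := -(b * L)) (fun S => by
      have := chernoff_exponent_le (by positivity) (h1 (h S)) (h2 (h S)) (by positivity)
      rw [← hb] at this
      refine le_trans (le_of_eq ?_) this
      ring)
  refine (MeasureTheory.measureReal_mono ?_ (by simp)).trans (hbound.trans ?_)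
  · intro G hG
    simp only [Set.mem_compl_iff, Set.mem_ofPred_eq, not_forall, not_exists, not_and] at hG
    obtain ⟨F, hFG, hF, hFc, hD⟩ := hG
    obtain ⟨⟨hA1, hA2, hA3⟩, S, hSF, hSs, hST⟩ := hh F.edgeFinset
      ⟨fun e he => F.not_isDiag_of_mem_edgeFinset he,
        tripleFree_of_cliqueFree hF fun e he => SimpleGraph.mem_edgeFinset.1 he⟩
    have hsub : F.edgeFinset ⊆ G.edgeFinset := SimpleGraph.edgeFinset_mono hFG
    refine ⟨S, hSs, hSF.trans hsub, ?_⟩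
    -- The fingerprint alone recovers the container of `F`, so the union bound need not range over
    -- `F`.
    rw [hST S subset_rfl hSF]
    refine (h3 (h F.edgeFinset) hA2 hA3 F hA1 ?_ ?_).trans ?_
    · rwa [Set.ncard_eq_toFinset_card'] at hFc
    · intro D hDF hbip
      by_contra hle
      exact hD D hDF (not_lt.1 hle) hbip
    · exact_mod_cast Finset.card_le_card (Finset.inter_subset_inter_right hsub)
  · have hx0 : 0 < x := by linarith
    have e1 : x ^ s = Real.exp (s * Real.log x) := by
      rw [Real.exp_nat_mul, Real.exp_log hx0]
    rw [e1, ← Real.exp_add, ← Real.exp_add]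
    refine Real.exp_le_exp.2 ?_
    have e2 : (s : ℝ) * Real.log x ≤ b / 4 * L := by
      have h4 : (s : ℝ) * Real.log x ≤ c * (n * √n) * Real.log x := by gcongr
      have h5 : 4 * c * Real.log x / b * (n * √n) ≤ L := by
        have : 0 ≤ (n : ℝ) * √n := by positivity
        linarith
      have h6 : b / 4 * (4 * c * Real.log x / b * (n * √n)) = c * (n * √n) * Real.log x := by
        field_simp
      have h7 := mul_le_mul_of_nonneg_left h5 (by positivity : 0 ≤ b / 4)
      linarith
    have e3 : (n : ℝ) ^ 2 * ((1 + η / 2) * p / x) ≤ b / 4 * L := by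
      have h8 : (1 + η / 2) / x ≤ b / 4 := by
        rw [div_le_iff₀ hx0, hx, mul_add, mul_one]
        have : b / 4 * (8 / b) = 2 := by field_simp; norm_num
        linarith
      have h9 := mul_le_mul_of_nonneg_right h8 hL0
      refine le_trans (le_of_eq ?_) h9
      rw [hL]
      ring
    linarith

theorem theorem8p34 :
    ∀ η : ℝ, 0 < η → ∃ ε : ℝ, 0 < ε ∧ ∃ C : ℝ,
      ∀ p : ℕ → unitInterval,
        (∀ᶠ n : ℕ in atTop, C * (n : ℝ) ^ (-(1 / 2) : ℝ) < (p n : ℝ)) →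
        Tendsto
          (fun n : ℕ => SimpleGraph.binomialRandom (Fin n) (p n)
            {G : SimpleGraph (Fin n) |
              ∀ F : SimpleGraph (Fin n), F ≤ G → F.CliqueFree 3 →
                (1 - ε) * (n : ℝ) ^ 2 * (p n : ℝ) / 4 ≤ (F.edgeSet.ncard : ℝ) →
                ∃ D : Set (Sym2 (Fin n)), D ⊆ F.edgeSet ∧
                  (D.ncard : ℝ) ≤ η * (n : ℝ) ^ 2 * (p n : ℝ) ∧
                  (F.deleteEdges D).IsBipartite})
          atTop (𝓝 1) := by
  intro η hη
  -- The halving absorbs the factor 2 in `2 * η'`; the minimum ensures `η' ≤ 1 / 2`.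
  set η' : ℝ := min η 1 / 2 with hη'
  have h0 : 0 < η' := by positivity
  have h1 : η' ≤ 1 / 2 := by
    have := min_le_right η 1
    linarith
  have h2 : 2 * η' ≤ η := by
    have := min_le_left η 1
    linarith
  obtain ⟨a, ha, C, hC, hmain⟩ := exists_real_compl_le η' h0 h1
  refine ⟨η' / 2, by positivity, C, fun p hp => ?_⟩
  refine tendsto_measure_one_of_real_compl _ _ (fun n => (Set.toFinite _).measurableSet) ?_
  have hlim : Tendsto (fun n : ℕ => Real.exp (-(a * n))) atTop (𝓝 0) := by
    refine Real.tendsto_exp_atBot.comp (tendsto_neg_atTop_atBot.comp ?_)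
    exact tendsto_natCast_atTop_atTop.const_mul_atTop ha
  refine squeeze_zero' (Eventually.of_forall fun n => MeasureTheory.measureReal_nonneg) ?_ hlim
  filter_upwards [hp, eventually_gt_atTop 0] with n hpn hn
  have hn1 : (1 : ℝ) ≤ n := by exact_mod_cast hn
  have hL : C * (n * √n) ≤ (n : ℝ) ^ 2 * p n := by
    have e : (n : ℝ) ^ 2 * (n : ℝ) ^ (-(1 / 2) : ℝ) = n * √n := by
      rw [Real.sqrt_eq_rpow, ← Real.rpow_natCast, ← Real.rpow_add (by positivity)]
      nth_rewrite 2 [← Real.rpow_one (n : ℝ)]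
      rw [← Real.rpow_add (by positivity)]
      norm_num
    rw [← e]
    have := mul_le_mul_of_nonneg_left hpn.le (sq_nonneg (n : ℝ))
    linarith
  -- `C ≥ 1` gives `n²p ≥ n`, so the failure probability is at most `exp(-an)`.
  have hnL : (n : ℝ) ≤ (n : ℝ) ^ 2 * p n := by
    have hs : 1 ≤ √(n : ℝ) := Real.one_le_sqrt.2 hn1
    have h3 : (n : ℝ) ≤ n * √n := le_mul_of_one_le_right (by positivity) hs
    have h4 : n * √(n : ℝ) ≤ C * (n * √n) := le_mul_of_one_le_left (by positivity) hC
    linarith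
  refine le_trans (MeasureTheory.measureReal_mono ?_ (by simp)) ((hmain n (p n) hn hL).trans ?_)
  · refine Set.compl_subset_compl.2 fun G hG F hFG hF hc => ?_
    obtain ⟨D, hD, hDc, hb⟩ := hG F hFG hF hc
    refine ⟨D, hD, hDc.trans ?_, hb⟩
    have : (0 : ℝ) ≤ p n := (p n).2.1
    gcongr
  · refine Real.exp_le_exp.2 (neg_le_neg ?_)
    gcongr
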